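/- Let $D \subset \mathbb{C}^n$ be a bounded, balanced, convex domain, that is, a non-empty bounded open convex set with $\lambda z \in D$ whenever $z \in D$, $\lambda \in \mathbb{C}$ and $|\lambda| \le 1$. A map $G : D \to \mathbb{C}^n$ is called an infinitesimal generator on $D$ if it is holomorphic and for every $z_0 \in D$ the Cauchy problem \[ \dot z(t) = G(z(t)), \qquad z(0) = z_0, \] has a solution $z : [0,+\infty) \to D$. Let $\{G_m\}_{m \in \mathbb{N}}$ be a sequence of infinitesimal generators on $D$, and suppose that there exists $C > 0$ such that \[ \|G_m(0)\| + \|G_m'(0)\| \le C \qquad \text{for all } m \in \mathbb{N}, \] where $\|G_m(0)\|$ is the Euclidean norm and $\|G_m'(0)\|$ is the operator norm of the differential of $G_m$ at $0$. Then there exists a subsequence of $\{G_m\}$ which converges uniformly on compact subsets of $D$ to an infinitesimal generator on $D$. -/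

import Mathlib

open Set Filter

/-- `G` is an infinitesimal generator on `D ⊆ ℂⁿ`: it is holomorphic on `D` and, for every
`z₀ ∈ D`, the Cauchy problem `z'(t) = G (z t)`, `z 0 = z₀` has a solution `[0, +∞) → D`.
Only the values of `G` on `D` matter; the derivative at `t = 0` is the one from the right. -/
def IsInfinitesimalGenerator {n : ℕ} (D : Set (EuclideanSpace ℂ (Fin n)))
    (G : EuclideanSpace ℂ (Fin n) → EuclideanSpace ℂ (Fin n)) : Prop :=
  DifferentiableOn ℂ G D ∧
    ∀ z₀ ∈ D, ∃ z : ℝ → EuclideanSpace ℂ (Fin n), z 0 = z₀ ∧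
      (∀ t : ℝ, 0 ≤ t → z t ∈ D) ∧ IsIntegralCurveOn z (fun _ => G) (Ici 0)

/-!
The gauge of a bounded balanced convex domain is a norm whose open unit ball is the domain, so it
suffices to treat the unit ball of a finite-dimensional complex normed space.

*A priori bound.* The flow of a generator `G` consists of holomorphic self-maps of the ball: for
short times it is the uniform limit of Euler polygons, and longer times follow by composition
(`differentiableOn_trajectory`). If `u` is a unit vector and `ℓ` a functional of norm at most `1`
with `ℓ u = 1`, then `ζ ↦ ℓ (F_t (ζ u))` is a self-map of the unit disc. Differentiating the
Schwarz–Pick inequality at `t = 0` gives the Berkson–Porta inequality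
`Re (conj ζ * ℓ (G (ζ u))) ≤ Re (conj ζ * ℓ (G 0)) * (1 - |ζ|²)`
(`IsSemigroupGenerator.re_conj_mul_le`). With the Borel–Carathéodory theorem it bounds the numerical
range of `G` on smaller balls in terms of `G 0` and `G' 0` (`IsSemigroupGenerator.norm_apply_le`).
A bound of the numerical range bounds the map itself (`norm_le_of_numericalRange_bound`): for a small
complex `s`, the Euler polygon of `G` with total time `s` cannot leave a slightly larger ball, since
the norm grows only as fast as the numerical range allows; it is holomorphic in `s` with derivative
`G x` at `0`, and Cauchy's estimate applies.

*Compactness.* By Montel's theorem a subsequence converges uniformly on smaller balls, and the limit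
is holomorphic. The case `ζ = ‖x‖` of the Berkson–Porta inequality shows that the distance of a
trajectory to the sphere decreases at most exponentially, at a rate depending only on `‖G 0‖`
(`IsSemigroupGenerator.norm_trajectory_le`). Hence the trajectories of the subsequence from a given
point stay in a common compact set over bounded times, converge by Grönwall's inequality, and have as
limit a global trajectory of the limit field (`isSemigroupGenerator_of_tendsto`).
-/

open Metric Topology NNReal ComplexConjugate

/-! ### Cauchy estimates in several variables -/

section CauchyEstimates

variable {V W : Type*} [NormedAddCommGroup V] [NormedSpace ℂ V]
  [NormedAddCommGroup W] [NormedSpace ℂ W]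

/-- Cauchy's estimate, with a factor `2` that comes from recentring `f` in the Schwarz lemma. -/
lemma norm_fderiv_le_of_norm_le_on_ball {f : V → W} {x : V} {δ M : ℝ} (hδ : 0 < δ)
    (hd : DifferentiableOn ℂ f (ball x δ)) (hM : ∀ y ∈ ball x δ, ‖f y‖ ≤ M) :
    ‖fderiv ℂ f x‖ ≤ 2 * M / δ := by
  refine Complex.norm_fderiv_le_div_of_mapsTo_ball hd (fun y hy => ?_) hδ
  rw [mem_closedBall, dist_eq_norm]
  linarith [norm_sub_le (f y) (f x), hM y hy, hM x (mem_ball_self hδ)]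

lemma norm_sub_le_of_norm_le_on_ball {f : V → W} {r R M : ℝ} (hrR : r < R)
    (hd : DifferentiableOn ℂ f (ball 0 R)) (hM : ∀ y ∈ ball 0 R, ‖f y‖ ≤ M) {x y : V}
    (hx : ‖x‖ ≤ r) (hy : ‖y‖ ≤ r) : ‖f x - f y‖ ≤ 2 * M / (R - r) * ‖x - y‖ := by
  refine Convex.norm_image_sub_le_of_norm_fderiv_le (𝕜 := ℂ) (s := closedBall 0 r)
    (fun w hw => ?_) (fun w hw => ?_) (convex_closedBall 0 r) (by simpa using hy) (by simpa using hx)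
  · rw [mem_closedBall_zero_iff] at hw
    exact hd.differentiableAt (isOpen_ball.mem_nhds (by simpa using hw.trans_lt hrR))
  · rw [mem_closedBall_zero_iff] at hw
    have hsub : ball w (R - r) ⊆ ball 0 R := by
      apply ball_subset_ball'
      rw [dist_zero_right]; linarith
    exact norm_fderiv_le_of_norm_le_on_ball (by linarith) (hd.mono hsub) fun y hy => hM y (hsub hy)

lemma exists_norm_le_of_continuousOn_ball {V W : Type*} [NormedAddCommGroup V] [ProperSpace V]
    [NormedAddCommGroup W] {f : V → W} (hf : ContinuousOn f (ball 0 1)) {r : ℝ}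
    (hr : r < 1) : ∃ M : ℝ, 0 < M ∧ ∀ x, ‖x‖ ≤ r → ‖f x‖ < M := by
  obtain ⟨M, hM⟩ := (isCompact_closedBall (0 : V) r).exists_bound_of_continuousOn
    (hf.mono (closedBall_subset_ball hr))
  exact ⟨max M 0 + 1, by positivity, fun x hx =>
    lt_of_le_of_lt ((hM x (by simpa using hx)).trans (le_max_left _ _)) (lt_add_one _)⟩

lemma exists_lipschitzOnWith_closedBall [ProperSpace V] {f : V → W}
    (hf : DifferentiableOn ℂ f (ball 0 1)) {r : ℝ} (hr : r < 1) : ∃ L : ℝ≥0, LipschitzOnWith L f (closedBall 0 r) := by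
  obtain ⟨R, hrR, hR⟩ := exists_between hr
  obtain ⟨M, hM0, hM⟩ := exists_norm_le_of_continuousOn_ball hf.continuousOn hR
  refine ⟨(2 * M / (R - r)).toNNReal, LipschitzOnWith.of_dist_le_mul fun x hx y hy => ?_⟩
  rw [mem_closedBall_zero_iff] at hx hy
  rw [dist_eq_norm, dist_eq_norm, Real.coe_toNNReal _ (by have := sub_pos.2 hrR; positivity)]
  exact norm_sub_le_of_norm_le_on_ball hrR (hf.mono (ball_subset_ball hR.le))
    (fun y hy => (hM y (by simpa using (mem_ball_zero_iff.1 hy).le)).le) hx hy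

end CauchyEstimates

/-! ### Trajectories of a vector field -/

section Trajectories

variable {V : Type*} [NormedAddCommGroup V] [NormedSpace ℂ V]

/-- `z` is a forward trajectory of the autonomous vector field `G` that never leaves `D`: it solves
`z' = G ∘ z` on `[0, ∞)`, with the right derivative at `0`. -/
def IsTrajectory (D : Set V) (G : V → V) (z : ℝ → V) : Prop :=
  (∀ t : ℝ, 0 ≤ t → z t ∈ D) ∧ IsIntegralCurveOn z (fun _ => G) (Ici 0)

/-- Infinitesimal generators on a subset of an arbitrary complex normed space. On Euclidean space
this is definitionally `IsInfinitesimalGenerator`. -/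
def IsSemigroupGenerator (D : Set V) (G : V → V) : Prop :=
  DifferentiableOn ℂ G D ∧ ∀ z₀ ∈ D, ∃ z : ℝ → V, z 0 = z₀ ∧ IsTrajectory D G z

variable {D : Set V} {G : V → V} {z : ℝ → V}

lemma IsTrajectory.hasDerivWithinAt (hz : IsTrajectory D G z) {t : ℝ} (ht : 0 ≤ t) :
    HasDerivWithinAt z (G (z t)) (Ici 0) t := hz.2 t ht

lemma IsTrajectory.continuousOn (hz : IsTrajectory D G z) : ContinuousOn z (Ici 0) :=
  fun _ ht => (hz.hasDerivWithinAt ht).continuousWithinAt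

lemma IsTrajectory.hasDerivWithinAt_Ici (hz : IsTrajectory D G z) {t : ℝ} (ht : 0 ≤ t) :
    HasDerivWithinAt z (G (z t)) (Ici t) t :=
  (hz.hasDerivWithinAt ht).mono (Ici_subset_Ici.2 ht)

lemma IsTrajectory.shift (hz : IsTrajectory D G z) {s : ℝ} (hs : 0 ≤ s) :
    IsTrajectory D G (fun t => z (s + t)) := by
  refine ⟨fun t ht => hz.1 _ (by positivity), fun t ht => ?_⟩
  have h1 := hz.hasDerivWithinAt (t := s + t) (add_nonneg hs ht)
  have h2 : HasDerivWithinAt (fun t : ℝ => s + t) 1 (Ici 0) t :=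
    (hasDerivWithinAt_id t _).const_add s
  have := h1.scomp t h2 (fun x hx => add_nonneg hs hx)
  rw [one_smul] at this
  exact this

/-- A trajectory in the open unit ball stays away from the boundary over a bounded time interval. -/
lemma IsTrajectory.exists_norm_le (hz : IsTrajectory (ball 0 1) G z) (T : ℝ) (hT : 0 ≤ T) :
    ∃ r < 1, ∀ t ∈ Icc 0 T, ‖z t‖ ≤ r := by
  obtain ⟨t, ht, hmax⟩ := (isCompact_Icc (a := (0 : ℝ)) (b := T)).exists_isMaxOn
    ⟨0, by simp [hT]⟩ (hz.continuousOn.norm.mono Icc_subset_Ici_self)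
  exact ⟨‖z t‖, by simpa using hz.1 t ht.1, fun s hs => hmax hs⟩

/-- A trajectory whose speed is below `M` in the ball of radius `r'` cannot leave that ball too
early. -/
lemma IsTrajectory.norm_le_of_speed (hz : IsTrajectory D G z) {r r' M h : ℝ}
    (h0 : ‖z 0‖ ≤ r) (hM0 : 0 ≤ M) (hM : ∀ x, ‖x‖ ≤ r' → ‖G x‖ < M) (hh : r + h * M ≤ r')
    {t : ℝ} (ht : t ∈ Icc 0 h) : ‖z t‖ ≤ r' := by
  have key : ∀ ⦃t⦄, t ∈ Icc 0 h → ‖z t‖ ≤ r + M * t := by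
    refine image_norm_le_of_norm_deriv_right_lt_deriv_boundary (f' := fun t => G (z t))
      (B' := fun _ => M) (hz.continuousOn.mono Icc_subset_Ici_self)
      (fun t ht => hz.hasDerivWithinAt_Ici ht.1) (by simpa using h0) (fun t => ?_)
      (fun t ht he => hM _ ?_)
    · simpa using ((hasDerivAt_id t).const_mul M).const_add r
    · rw [he]; nlinarith [ht.2]
  have := key ht
  nlinarith [ht.2]

/-- Local error of one step of the Euler method. -/
lemma IsTrajectory.norm_sub_sub_smul_le (hz : IsTrajectory D G z) {r' M h : ℝ} {L : ℝ≥0}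
    (hM : ∀ x, ‖x‖ ≤ r' → ‖G x‖ < M) (hL : LipschitzOnWith L G (closedBall 0 r'))
    (hr' : ∀ t ∈ Icc 0 h, ‖z t‖ ≤ r') {s η : ℝ} (hs : 0 ≤ s) (hη : 0 ≤ η) (hsη : s + η ≤ h) :
    ‖z (s + η) - z s - η • G (z s)‖ ≤ L * M * η ^ 2 := by
  have hI : Icc s (s + η) ⊆ Icc 0 h := Icc_subset_Icc hs hsη
  have hI' : Icc s (s + η) ⊆ Ici 0 := hI.trans Icc_subset_Ici_self
  have hspeed : ∀ t ∈ Icc s (s + η), ‖z t - z s‖ ≤ M * η := by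
    intro t ht
    have := Convex.norm_image_sub_le_of_norm_hasDerivWithin_le (s := Icc s (s + η))
      (f := z) (f' := fun t => G (z t)) (C := M)
      (fun t ht => (hz.hasDerivWithinAt (hI' ht)).mono hI')
      (fun t ht => (hM _ (hr' t (hI ht))).le) (convex_Icc _ _) (left_mem_Icc.2 (by linarith)) ht
    refine this.trans ?_
    have hM0 : 0 ≤ M := (norm_nonneg _).trans (hM _ (hr' t (hI ht))).le
    rw [Real.norm_eq_abs, abs_of_nonneg (by linarith [ht.1])]
    exact mul_le_mul_of_nonneg_left (by linarith [ht.2]) hM0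
  have := Convex.norm_image_sub_le_of_norm_hasDerivWithin_le (s := Icc s (s + η))
      (f := fun t => z t - t • G (z s)) (f' := fun t => G (z t) - G (z s)) (C := L * (M * η))
      (x := s) (y := s + η)
      (fun t ht => by
        have := ((hz.hasDerivWithinAt (hI' ht)).mono hI').sub
          ((hasDerivWithinAt_id t _).smul_const (G (z s)))
        rw [one_smul] at this
        exact this)
      (fun t ht => by
        rw [← dist_eq_norm]
        refine (hL.dist_le_mul _ (by simpa using hr' t (hI ht)) _
          (by simpa using hr' s (hI (left_mem_Icc.2 (by linarith))))).trans ?_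
        rw [dist_eq_norm]
        exact mul_le_mul_of_nonneg_left (hspeed t ht) L.2)
      (convex_Icc _ _) (left_mem_Icc.2 (by linarith)) (right_mem_Icc.2 (by linarith))
  have e : z (s + η) - z s - η • G (z s)
      = (z (s + η) - (s + η) • G (z s)) - (z s - s • G (z s)) := by
    rw [add_smul]; abel
  rw [e]
  refine this.trans (le_of_eq ?_)
  rw [Real.norm_eq_abs, abs_of_nonneg (by linarith)]
  ring

end Trajectories

/-! ### Euler polygons and holomorphic dependence on the initial point -/

section Euler

variable {V : Type*} [NormedAddCommGroup V] [NormedSpace ℂ V]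

/-- The `j`-th point of the Euler polygon of the vector field `G` with step `h`, started at `x`.
The step is complex, so that the point can depend holomorphically on it. -/
def eulerPoint (G : V → V) (h : ℂ) (x : V) : ℕ → V
  | 0 => x
  | j + 1 => eulerPoint G h x j + h • G (eulerPoint G h x j)

variable {G : V → V}

lemma norm_eulerPoint_le {r r' M : ℝ} {h : ℂ} {x : V} {N : ℕ} (hx : ‖x‖ ≤ r)
    (hM0 : 0 ≤ M) (hM : ∀ x, ‖x‖ ≤ r' → ‖G x‖ < M) (hN : r + N * ‖h‖ * M ≤ r') :
    ∀ j ≤ N, ‖eulerPoint G h x j‖ ≤ r + j * ‖h‖ * M := by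
  intro j
  induction j with
  | zero => intro _; simpa [eulerPoint] using hx
  | succ j ih =>
    intro hj
    have h1 := ih (by omega)
    have hjN : (j : ℝ) * (‖h‖ * M) ≤ N * (‖h‖ * M) := by
      gcongr; omega
    have h2 : ‖G (eulerPoint G h x j)‖ < M := hM _ (by linarith)
    rw [eulerPoint]
    refine (norm_add_le _ _).trans ?_
    rw [norm_smul]
    push_cast
    nlinarith [mul_le_mul_of_nonneg_left h2.le (norm_nonneg h)]

/-- Global error of the Euler method. -/
lemma norm_eulerPoint_sub_trajectory_le {D : Set V} {z : ℝ → V} (hz : IsTrajectory D G z)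
    {r r' M η : ℝ} {L : ℝ≥0} {N : ℕ} (hM0 : 0 ≤ M) (hη : 0 ≤ η)
    (hM : ∀ x, ‖x‖ ≤ r' → ‖G x‖ < M) (hL : LipschitzOnWith L G (closedBall 0 r'))
    (h0 : ‖z 0‖ ≤ r) (hN : r + N * η * M ≤ r') :
    ∀ j ≤ N, ‖eulerPoint G (η : ℂ) (z 0) j - z (j * η)‖ ≤ j * (L * M * η ^ 2) * (1 + L * η) ^ j := by
  have hstay : ∀ t ∈ Icc 0 (N * η), ‖z t‖ ≤ r' := fun t ht => hz.norm_le_of_speed h0 hM0 hM hN ht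
  have hηn : ‖(η : ℂ)‖ = η := by simp [abs_of_nonneg hη]
  intro j
  induction j with
  | zero => intro _; simp [eulerPoint]
  | succ j ih =>
    intro hj
    have hjN : (j : ℝ) * η + η ≤ N * η := by
      have : ((j : ℝ) + 1) ≤ N := by exact_mod_cast hj
      nlinarith
    have hj0 : 0 ≤ (j : ℝ) * η := by positivity
    have h1 := ih (by omega)
    have hE : ‖eulerPoint G (η : ℂ) (z 0) j‖ ≤ r' := by
      refine (norm_eulerPoint_le h0 hM0 hM (by rwa [hηn]) j (by omega)).trans ?_
      rw [hηn]; nlinarith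
    have hZ : ‖z (j * η)‖ ≤ r' := hstay _ ⟨hj0, by linarith⟩
    have hloc := hz.norm_sub_sub_smul_le hM hL hstay hj0 hη hjN
    have hLip := hL.dist_le_mul _ (mem_closedBall_zero_iff.2 hE) _ (mem_closedBall_zero_iff.2 hZ)
    rw [dist_eq_norm, dist_eq_norm] at hLip
    set x := eulerPoint G (η : ℂ) (z 0) j
    set y := z (j * η)
    have e : eulerPoint G (η : ℂ) (z 0) (j + 1) - z ((j + 1 : ℕ) * η)
        = (x - y) + η • (G x - G y) - (z (j * η + η) - y - η • G y) := by
      rw [eulerPoint, show ((j + 1 : ℕ) : ℝ) * η = j * η + η by push_cast; ring, Complex.coe_smul,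
        smul_sub]
      abel
    rw [e]
    have h2 : ‖(x - y) + η • (G x - G y)‖ ≤ (1 + L * η) * ‖x - y‖ := by
      refine (norm_add_le _ _).trans ?_
      rw [norm_smul, Real.norm_eq_abs, abs_of_nonneg hη]
      nlinarith
    have h3 : (1 : ℝ) ≤ (1 + L * η) ^ (j + 1) := one_le_pow₀ (by simp; positivity)
    have h4 : (1 + L * η) * ‖x - y‖ ≤ (1 + L * η) * (j * (L * M * η ^ 2) * (1 + L * η) ^ j) := by
      gcongr
    have h5 : 0 ≤ L * M * η ^ 2 := by positivity
    refine (norm_sub_le _ _).trans ?_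
    push_cast
    have h6 := mul_le_mul_of_nonneg_left h3 h5
    calc _ ≤ (1 + L * η) * (j * (L * M * η ^ 2) * (1 + L * η) ^ j) + L * M * η ^ 2 := by linarith
      _ = j * (L * M * η ^ 2) * (1 + L * η) ^ (j + 1) + L * M * η ^ 2 * 1 := by ring
      _ ≤ j * (L * M * η ^ 2) * (1 + L * η) ^ (j + 1)
          + L * M * η ^ 2 * (1 + L * η) ^ (j + 1) := by linarith
      _ = _ := by ring

lemma differentiableOn_eulerPoint {D : Set V} (hG : DifferentiableOn ℂ G D) {U : Set ℂ}
    {h : ℂ → ℂ} {γ : ℂ → V} (hh : DifferentiableOn ℂ h U) (hγ : DifferentiableOn ℂ γ U) {N : ℕ}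
    (hmem : ∀ ζ ∈ U, ∀ j < N, eulerPoint G (h ζ) (γ ζ) j ∈ D) :
    ∀ j ≤ N, DifferentiableOn ℂ (fun ζ => eulerPoint G (h ζ) (γ ζ) j) U := by
  intro j
  induction j with
  | zero => intro _; simpa [eulerPoint] using hγ
  | succ j ih =>
    intro hj
    have h1 := ih (by omega)
    simp only [eulerPoint]
    exact h1.add (hh.smul (hG.comp h1 fun ζ hζ => hmem ζ hζ j (by omega)))

/-- Holomorphic dependence on the initial point for a short time: the Euler points are holomorphic
in the parameter and converge uniformly to the time-`h` map. -/
lemma differentiableOn_trajectory_short [CompleteSpace V] {U : Set ℂ} (hU : IsOpen U)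
    (hG : DifferentiableOn ℂ G (ball 0 1)) {Z : ℂ → ℝ → V}
    (hZ : ∀ ζ ∈ U, IsTrajectory (ball 0 1) G (Z ζ))
    (hZ0 : DifferentiableOn ℂ (fun ζ => Z ζ 0) U) {r r' M h : ℝ} {L : ℝ≥0} (hr' : r' < 1)
    (h0 : ∀ ζ ∈ U, ‖Z ζ 0‖ ≤ r) (hM0 : 0 ≤ M) (hM : ∀ x, ‖x‖ ≤ r' → ‖G x‖ < M)
    (hL : LipschitzOnWith L G (closedBall 0 r')) (hh0 : 0 ≤ h) (hh : r + h * M ≤ r') :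
    DifferentiableOn ℂ (fun ζ => Z ζ h) U := by
  have hstep : ∀ N : ℕ, ((N + 1 : ℕ) : ℝ) * (h / (N + 1 : ℕ)) = h := fun N => by field_simp
  have hstepn : ∀ N : ℕ, ‖((h / (N + 1 : ℕ) : ℝ) : ℂ)‖ = h / (N + 1 : ℕ) := fun N => by
    rw [Complex.norm_real, Real.norm_eq_abs, abs_of_nonneg (by positivity)]
  have hdiff : ∀ N : ℕ, DifferentiableOn ℂ
      (fun ζ => eulerPoint G ((h / (N + 1 : ℕ) : ℝ) : ℂ) (Z ζ 0) (N + 1)) U := by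
    intro N
    refine differentiableOn_eulerPoint hG (differentiableOn_const _) hZ0 (fun ζ hζ j hj => ?_)
      (N + 1) le_rfl
    rw [mem_ball_zero_iff]
    refine (norm_eulerPoint_le (h0 ζ hζ) hM0 hM (N := N + 1) ?_ j hj.le).trans_lt ?_
    · rwa [hstepn, hstep]
    · rw [hstepn]
      have h1 : (j : ℝ) * (h / (N + 1 : ℕ)) ≤ ((N + 1 : ℕ) : ℝ) * (h / (N + 1 : ℕ)) := by
        gcongr
      rw [hstep] at h1
      nlinarith
  have hlim : TendstoUniformlyOn
      (fun (N : ℕ) ζ => eulerPoint G ((h / (N + 1 : ℕ) : ℝ) : ℂ) (Z ζ 0) (N + 1))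
      (fun ζ => Z ζ h) atTop U := by
    have hb : ∀ (N : ℕ), ∀ ζ ∈ U,
        ‖eulerPoint G ((h / (N + 1 : ℕ) : ℝ) : ℂ) (Z ζ 0) (N + 1) - Z ζ h‖
          ≤ (L * M * h ^ 2 * Real.exp (L * h)) * (1 / ((N : ℝ) + 1)) := by
      intro N ζ hζ
      have := norm_eulerPoint_sub_trajectory_le (hZ ζ hζ) (η := h / (N + 1 : ℕ)) (N := N + 1) hM0
        (by positivity) hM hL (h0 ζ hζ) (by rwa [hstep]) (N + 1) le_rfl
      rw [hstep] at this
      refine this.trans ?_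
      have hexp : (1 + L * (h / (N + 1 : ℕ))) ^ (N + 1) ≤ Real.exp (L * h) := by
        calc (1 + L * (h / (N + 1 : ℕ))) ^ (N + 1)
            ≤ Real.exp (L * (h / (N + 1 : ℕ))) ^ (N + 1) := by
              gcongr
              linarith [Real.add_one_le_exp ((L : ℝ) * (h / (N + 1 : ℕ)))]
          _ = Real.exp (L * h) := by
              rw [← Real.exp_nat_mul]; congr 1; field_simp
      have hc : ((N + 1 : ℕ) : ℝ) * (L * M * (h / (N + 1 : ℕ)) ^ 2)
          = L * M * h ^ 2 * (1 / ((N : ℝ) + 1)) := by push_cast; field_simp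
      rw [hc]
      calc _ ≤ L * M * h ^ 2 * (1 / ((N : ℝ) + 1)) * Real.exp (L * h) := by gcongr
        _ = _ := by ring
    have ht : Tendsto (fun N : ℕ => (L * M * h ^ 2 * Real.exp (L * h)) * (1 / ((N : ℝ) + 1)))
        atTop (𝓝 0) := by
      simpa using (tendsto_one_div_add_atTop_nhds_zero_nat (𝕜 := ℝ)).const_mul
        (L * M * h ^ 2 * Real.exp (L * h))
    rw [Metric.tendstoUniformlyOn_iff]
    intro ε hε
    filter_upwards [ht.eventually_lt_const hε] with N hN ζ hζ
    rw [dist_comm, dist_eq_norm]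
    exact (hb N ζ hζ).trans_lt hN
  exact hlim.tendstoLocallyUniformlyOn.differentiableOn (Eventually.of_forall hdiff) hU

/-- If the initial points of a family of trajectories depend holomorphically on a complex
parameter, then so do the points reached at any later time. -/
lemma differentiableOn_trajectory [ProperSpace V] {U : Set ℂ} (hU : IsOpen U)
    (hG : DifferentiableOn ℂ G (ball 0 1)) {Z : ℂ → ℝ → V}
    (hZ : ∀ ζ ∈ U, IsTrajectory (ball 0 1) G (Z ζ))
    (hZ0 : DifferentiableOn ℂ (fun ζ => Z ζ 0) U) {t : ℝ} (ht : 0 ≤ t) :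
    DifferentiableOn ℂ (fun ζ => Z ζ t) U := by
  intro ζ₀ hζ₀
  obtain ⟨r, hr1, hr⟩ := (hZ ζ₀ hζ₀).exists_norm_le t ht
  obtain ⟨r₁, hrr₁, hr₁⟩ := exists_between hr1
  obtain ⟨r₂, hr₁r₂, hr₂⟩ := exists_between hr₁
  obtain ⟨M, hM0, hM⟩ := exists_norm_le_of_continuousOn_ball hG.continuousOn hr₂
  obtain ⟨L, hL⟩ := exists_lipschitzOnWith_closedBall hG hr₂
  obtain ⟨N, hN⟩ := exists_nat_gt (t * M / (r₂ - r₁))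
  have hNpos : (0 : ℝ) < N := lt_of_le_of_lt (by have := sub_pos.2 hr₁r₂; positivity) hN
  have hh : r₁ + t / N * M ≤ r₂ := by
    rw [div_lt_iff₀ (sub_pos.2 hr₁r₂)] at hN
    have : t / N * M ≤ r₂ - r₁ := by
      rw [div_mul_eq_mul_div, div_le_iff₀ hNpos]; linarith
    linarith
  -- The neighbourhood of `ζ₀` shrinks at every short step, so that the step starts in the ball of
  -- radius `r₁`.
  have key : ∀ j ≤ N, ∃ U' ⊆ U, IsOpen U' ∧ ζ₀ ∈ U' ∧
      DifferentiableOn ℂ (fun ζ => Z ζ (j * (t / N))) U' := by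
    intro j
    induction j with
    | zero => intro _; exact ⟨U, subset_rfl, hU, hζ₀, by simpa using hZ0⟩
    | succ j ih =>
      intro hj
      obtain ⟨U', hU'U, hU', hζ', hd⟩ := ih (by omega)
      have hjt : (j : ℝ) * (t / N) ∈ Icc 0 t := by
        refine ⟨by positivity, ?_⟩
        rw [mul_div_assoc', div_le_iff₀ hNpos, mul_comm]
        have : (j : ℝ) ≤ N := by exact_mod_cast (by omega : j ≤ N)
        gcongr
      refine ⟨U' ∩ (fun ζ => Z ζ (j * (t / N))) ⁻¹' ball 0 r₁, inter_subset_left.trans hU'U,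
        hd.continuousOn.isOpen_inter_preimage hU' isOpen_ball,
        ⟨hζ', by simpa using (hr _ hjt).trans_lt hrr₁⟩, ?_⟩
      have := differentiableOn_trajectory_short (G := G)
        (hd.continuousOn.isOpen_inter_preimage hU' isOpen_ball) hG
        (Z := fun ζ s => Z ζ (j * (t / N) + s)) (fun ζ hζ => (hZ ζ (hU'U hζ.1)).shift hjt.1)
        (by simpa using hd.mono inter_subset_left) hr₂
        (fun ζ hζ => by simpa using (mem_ball_zero_iff.1 hζ.2).le) hM0.le hM hL
        (by positivity : 0 ≤ t / N) hh
      convert this using 3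
      push_cast; ring
  obtain ⟨U', -, hU', hζ', hd⟩ := key N le_rfl
  rw [mul_div_cancel₀ _ hNpos.ne'] at hd
  exact (hd.differentiableAt (hU'.mem_nhds hζ')).differentiableWithinAt

end Euler

/-! ### Generators on the unit disc -/

section UnitDisc

/-- The two-point **Schwarz–Pick lemma**, with one of the points at the origin. -/
lemma norm_sub_le_of_mapsTo_unitBall {f : ℂ → ℂ} (hd : DifferentiableOn ℂ f (ball 0 1))
    (hf : MapsTo f (ball 0 1) (ball 0 1)) {ζ : ℂ} (hζ : ζ ∈ ball (0 : ℂ) 1) :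
    ‖f ζ - f 0‖ ≤ ‖ζ‖ * ‖1 - conj (f 0) * f ζ‖ := by
  have h0 : ‖f 0‖ < 1 := by simpa using hf (mem_ball_self one_pos)
  have hne : ∀ w : ℂ, ‖w‖ < 1 → 1 - conj (f 0) * w ≠ 0 := by
    intro w hw h
    have h1 : ‖conj (f 0) * w‖ = 1 := by rw [← sub_eq_zero.1 h, norm_one]
    rw [norm_mul, RCLike.norm_conj] at h1
    nlinarith [norm_nonneg w, norm_nonneg (f 0)]
  have hle : ∀ w : ℂ, ‖w‖ < 1 → ‖w - f 0‖ ≤ ‖1 - conj (f 0) * w‖ := by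
    intro w hw
    rw [← sq_le_sq₀ (norm_nonneg _) (norm_nonneg _), ← Complex.normSq_eq_norm_sq,
      ← Complex.normSq_eq_norm_sq]
    have h1 : Complex.normSq w < 1 := by
      rw [Complex.normSq_eq_norm_sq]; nlinarith [norm_nonneg w]
    have h2 : Complex.normSq (f 0) < 1 := by
      rw [Complex.normSq_eq_norm_sq]; nlinarith [norm_nonneg (f 0)]
    simp only [Complex.normSq_apply, Complex.sub_re, Complex.sub_im, Complex.one_re, Complex.one_im,
      Complex.mul_re, Complex.mul_im, Complex.conj_re, Complex.conj_im] at h1 h2 ⊢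
    nlinarith [mul_pos (sub_pos.2 h1) (sub_pos.2 h2)]
  have hmem : ∀ w ∈ ball (0 : ℂ) 1, ‖f w‖ < 1 := fun w hw => by simpa using hf hw
  have key := Complex.norm_le_norm_of_mapsTo_ball (R := 1)
    (f := fun w => (f w - f 0) / (1 - conj (f 0) * f w)) (z := ζ)
    ((hd.sub_const _).div ((hd.const_mul _).const_sub _) fun w hw => hne _ (hmem w hw))
    (fun w hw => by
      rw [mem_closedBall_zero_iff, norm_div]
      exact div_le_one_of_le₀ (hle _ (hmem w hw)) (norm_nonneg _))
    (by simp) (by simpa using hζ)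
  rw [norm_div, div_le_iff₀ (norm_pos_iff.2 (hne _ (hmem ζ hζ)))] at key
  exact key

lemma HasDerivWithinAt.nonneg_of_nonneg_Ici {φ : ℝ → ℝ} {φ' a : ℝ}
    (h : HasDerivWithinAt φ φ' (Ici a) a) (ha : φ a = 0) (hφ : ∀ t, a ≤ t → 0 ≤ φ t) :
    0 ≤ φ' := by
  have h1 := hasDerivWithinAt_iff_tendsto_slope.1 h
  rw [Ici_sdiff_left] at h1
  refine ge_of_tendsto h1 ?_
  filter_upwards [self_mem_nhdsWithin] with t ht
  rw [slope_def_field, ha, sub_zero]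
  exact div_nonneg (hφ t (le_of_lt ht)) (sub_nonneg.2 (le_of_lt ht))

/-- The **Berkson–Porta inequality** for the initial velocity `g` of a one-parameter family of
holomorphic self-maps of the unit disc issuing from the identity: it is the Schwarz–Pick lemma
differentiated at time `0`. -/
lemma re_conj_mul_le_of_selfMaps {f : ℂ → ℝ → ℂ} {g : ℂ → ℂ}
    (hd : ∀ t, 0 ≤ t → DifferentiableOn ℂ (fun ζ => f ζ t) (ball 0 1))
    (hf : ∀ t, 0 ≤ t → MapsTo (fun ζ => f ζ t) (ball 0 1) (ball 0 1))
    (hf0 : ∀ ζ ∈ ball (0 : ℂ) 1, f ζ 0 = ζ)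
    (hg : ∀ ζ ∈ ball (0 : ℂ) 1, HasDerivWithinAt (f ζ) (g ζ) (Ici 0) 0)
    {ζ : ℂ} (hζ : ζ ∈ ball (0 : ℂ) 1) :
    (conj ζ * g ζ).re ≤ (conj ζ * g 0).re * (1 - ‖ζ‖ ^ 2) := by
  have h0 : (0 : ℂ) ∈ ball (0 : ℂ) 1 := mem_ball_self one_pos
  have hA : HasDerivWithinAt (fun t => f ζ t - f 0 t) (g ζ - g 0) (Ici 0) 0 :=
    (hg ζ hζ).sub (hg 0 h0)
  have hB : HasDerivWithinAt (fun t => 1 - conj (f 0 t) * f ζ t)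
      (-(conj (g 0) * f ζ 0 + conj (f 0 0) * g ζ)) (Ici 0) 0 :=
    ((hg 0 h0).star.mul (hg ζ hζ)).const_sub 1
  have hφ := (hB.norm_sq.const_mul (‖ζ‖ ^ 2)).sub hA.norm_sq
  have := hφ.nonneg_of_nonneg_Ici (by simp [hf0 ζ hζ, hf0 0 h0]) (fun t ht => by
    have := norm_sub_le_of_mapsTo_unitBall (hd t ht) (hf t ht) hζ
    have h2 := pow_le_pow_left₀ (norm_nonneg _) this 2
    rw [mul_pow] at h2
    exact sub_nonneg.2 h2)
  rw [hf0 ζ hζ, hf0 0 h0] at this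
  simp only [Complex.inner, map_zero, zero_mul, sub_zero, map_one, add_zero, mul_one,
    Complex.neg_re] at this
  have e : (conj (g 0) * ζ).re = (conj ζ * g 0).re := by
    simp only [Complex.mul_re, Complex.conj_re, Complex.conj_im]; ring
  have e' : ((g ζ - g 0) * conj ζ).re = (conj ζ * g ζ).re - (conj ζ * g 0).re := by
    rw [sub_mul, Complex.sub_re, mul_comm (g ζ), mul_comm (g 0)]
  rw [e, e'] at this
  linarith

/-- The growth estimate that follows from the Berkson–Porta inequality:
`g ζ = g 0 - conj (g 0) ζ² + ζ p ζ` with `Re p ≤ 0`, and `p` is controlled by the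
Borel–Carathéodory theorem. -/
lemma norm_le_of_re_conj_mul_le {g : ℂ → ℂ} (hg : DifferentiableOn ℂ g (ball 0 1))
    (h : ∀ ζ ∈ ball (0 : ℂ) 1, (conj ζ * g ζ).re ≤ (conj ζ * g 0).re * (1 - ‖ζ‖ ^ 2))
    {ζ : ℂ} (hζ : ζ ∈ ball (0 : ℂ) 1) :
    ‖g ζ‖ ≤ 2 * ‖g 0‖ + (2 + 2 * ‖deriv g 0‖) / (1 - ‖ζ‖) := by
  set q : ℂ → ℂ := fun ζ => g ζ + conj (g 0) * ζ ^ 2 with hq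
  have hqd : DifferentiableOn ℂ q (ball 0 1) := by fun_prop
  have hpd : DifferentiableOn ℂ (dslope q 0) (ball 0 1) :=
    (Complex.differentiableOn_dslope (ball_mem_nhds _ one_pos)).2 hqd
  have hq0 : q 0 = g 0 := by simp [hq]
  have hp0 : dslope q 0 0 = deriv g 0 := by
    rw [dslope_same]
    have h1 : HasDerivAt g (deriv g 0) 0 :=
      (hg.differentiableAt (ball_mem_nhds _ one_pos)).hasDerivAt
    have := (h1.fun_add (((hasDerivAt_id (0 : ℂ)).fun_pow 2).const_mul (conj (g 0)))).deriv
    simpa using this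
  have hfac : ∀ w, g w = g 0 - conj (g 0) * w ^ 2 + w * dslope q 0 w := by
    intro w
    have := sub_smul_dslope q 0 w
    rw [sub_zero, smul_eq_mul, hq0] at this
    rw [this, hq]; ring
  have hre' : ∀ w ∈ ball (0 : ℂ) 1, w ≠ 0 → (dslope q 0 w).re ≤ 0 := by
    intro w hw hw0
    have h1 := h w hw
    have hn : 0 < ‖w‖ ^ 2 := by have := norm_pos_iff.2 hw0; positivity
    have e : (conj w * g w).re = (conj w * g 0).re * (1 - ‖w‖ ^ 2)
        + ‖w‖ ^ 2 * (dslope q 0 w).re := by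
      conv_lhs => rw [hfac w]
      rw [← Complex.normSq_eq_norm_sq, Complex.normSq_apply]
      simp only [pow_two, Complex.mul_re, Complex.mul_im, Complex.conj_re, Complex.conj_im,
        Complex.add_re, Complex.add_im, Complex.sub_re, Complex.sub_im]
      ring
    nlinarith
  -- The real part is at most `0`; the weaker bound `1` suits the Borel–Carathéodory theorem, which
  -- asks for a positive one.
  have hre : MapsTo (dslope q 0) (ball 0 1) {z | z.re ≤ 1} := by
    intro w hw
    rcases eq_or_ne w 0 with rfl | hw0
    · have hc : ContinuousAt (dslope q 0) 0 :=
        hpd.continuousOn.continuousAt (ball_mem_nhds _ one_pos)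
      have ht : Tendsto (fun w => (dslope q 0 w).re) (𝓝[≠] 0) (𝓝 (dslope q 0 0).re) :=
        (Complex.continuous_re.tendsto _).comp (hc.tendsto.mono_left nhdsWithin_le_nhds)
      have : (dslope q 0 0).re ≤ 0 := le_of_tendsto ht (by
        filter_upwards [self_mem_nhdsWithin, mem_nhdsWithin_of_mem_nhds (ball_mem_nhds _ one_pos)]
          with w hw hw' using hre' w hw' hw)
      exact this.trans zero_le_one
    · exact (hre' w hw hw0).trans zero_le_one
  have hBC := Complex.borelCaratheodory one_pos hpd hre one_pos hζ
  rw [hp0] at hBC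
  have hζ1 : ‖ζ‖ < 1 := by simpa using hζ
  have hpos : 0 < 1 - ‖ζ‖ := by linarith
  have hp : ‖dslope q 0 ζ‖ ≤ (2 + 2 * ‖deriv g 0‖) / (1 - ‖ζ‖) := by
    refine hBC.trans ?_
    rw [← add_div]
    refine div_le_div_of_nonneg_right ?_ hpos.le
    nlinarith [norm_nonneg ζ, norm_nonneg (deriv g 0)]
  rw [hfac ζ]
  refine (norm_add_le _ _).trans (add_le_add ((norm_sub_le _ _).trans ?_) ?_)
  · rw [norm_mul, norm_pow, RCLike.norm_conj]
    have : ‖ζ‖ ^ 2 ≤ 1 := pow_le_one₀ (norm_nonneg _) hζ1.le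
    nlinarith [norm_nonneg (g 0)]
  · rw [norm_mul]
    refine le_trans ?_ hp
    nlinarith [norm_nonneg (dslope q 0 ζ)]

end UnitDisc

/-! ### Growth of generators and the numerical range -/

section NumericalRange

variable {V : Type*} [NormedAddCommGroup V] [NormedSpace ℂ V] {G : V → V}

lemma norm_apply_le_of_norm_le_one {ℓ : V →L[ℂ] ℂ} (hℓ : ‖ℓ‖ ≤ 1) (x : V) : ‖ℓ x‖ ≤ ‖x‖ :=
  (ℓ.le_opNorm x).trans (mul_le_of_le_one_left (norm_nonneg x) hℓ)

lemma smul_mem_unitBall {u : V} (hu : ‖u‖ ≤ 1) {ζ : ℂ} (hζ : ζ ∈ ball (0 : ℂ) 1) :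
    ζ • u ∈ ball (0 : V) 1 := by
  rw [mem_ball_zero_iff] at hζ ⊢
  rw [norm_smul]
  nlinarith [norm_nonneg ζ, norm_nonneg u]

lemma exists_unit_smul_eq_of_apply_eq_norm {x : V} (hx : x ≠ 0) {ℓ : V →L[ℂ] ℂ}
    (hℓx : ℓ x = ‖x‖) : ∃ u : V, ‖u‖ = 1 ∧ (‖x‖ : ℂ) • u = x ∧ ℓ u = 1 := by
  have hn : (‖x‖ : ℂ) ≠ 0 := by simpa using hx
  refine ⟨(‖x‖ : ℂ)⁻¹ • x, ?_, ?_, ?_⟩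
  · rw [norm_smul, norm_inv, Complex.norm_real, norm_norm, inv_mul_cancel₀ (norm_ne_zero_iff.2 hx)]
  · rw [smul_smul, mul_inv_cancel₀ hn, one_smul]
  · rw [map_smul, hℓx, smul_eq_mul, inv_mul_cancel₀ hn]

/-- The Berkson–Porta inequality on the slice spanned by a unit vector `u`: composing the flow with
a functional supporting the ball at `u` yields self-maps of the unit disc. -/
lemma IsSemigroupGenerator.re_conj_mul_le [ProperSpace V]
    (hG : IsSemigroupGenerator (ball 0 1) G)
    {u : V} (hu : ‖u‖ ≤ 1) {ℓ : V →L[ℂ] ℂ} (hℓ : ‖ℓ‖ ≤ 1) (hℓu : ℓ u = 1)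
    {ζ : ℂ} (hζ : ζ ∈ ball (0 : ℂ) 1) :
    (conj ζ * ℓ (G (ζ • u))).re ≤ (conj ζ * ℓ (G 0)).re * (1 - ‖ζ‖ ^ 2) := by
  choose! F hF0 hF using hG.2
  have := re_conj_mul_le_of_selfMaps (f := fun ζ t => ℓ (F (ζ • u) t))
    (g := fun ζ => ℓ (G (ζ • u)))
    (fun t ht => ℓ.differentiable.comp_differentiableOn
      (differentiableOn_trajectory isOpen_ball hG.1 (Z := fun ζ => F (ζ • u))
        (fun ζ hζ => hF _ (smul_mem_unitBall hu hζ))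
        (DifferentiableOn.congr (f := fun ζ : ℂ => ζ • u) (by fun_prop)
          fun ζ hζ => hF0 _ (smul_mem_unitBall hu hζ)) ht))
    (fun t ht ζ hζ => by
      rw [mem_ball_zero_iff]
      exact (norm_apply_le_of_norm_le_one hℓ _).trans_lt
        (by simpa using (hF _ (smul_mem_unitBall hu hζ)).1 t ht))
    (fun ζ hζ => by
      simp only [hF0 _ (smul_mem_unitBall hu hζ), map_smul, hℓu, smul_eq_mul, mul_one])
    (fun ζ hζ => by
      have h1 := (hF _ (smul_mem_unitBall hu hζ)).hasDerivWithinAt le_rfl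
      rw [hF0 _ (smul_mem_unitBall hu hζ)] at h1
      exact (ℓ.restrictScalars ℝ).hasFDerivAt.comp_hasDerivWithinAt 0 h1) hζ
  simpa using this

/-- The numerical range of a generator at a point of the unit ball is controlled by the `1`-jet of
the generator at the origin. -/
lemma IsSemigroupGenerator.norm_apply_le [ProperSpace V]
    (hG : IsSemigroupGenerator (ball 0 1) G) {C : ℝ} (hC : ‖G 0‖ + ‖fderiv ℂ G 0‖ ≤ C)
    {x : V} (hx : ‖x‖ < 1) {ℓ : V →L[ℂ] ℂ} (hℓ : ‖ℓ‖ ≤ 1) (hℓx : ℓ x = ‖x‖) :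
    ‖ℓ (G x)‖ ≤ 2 * C + (2 + 2 * C) / (1 - ‖x‖) := by
  have hG0 : ‖G 0‖ ≤ C := by linarith [norm_nonneg (fderiv ℂ G 0)]
  have hG1 : ‖fderiv ℂ G 0‖ ≤ C := by linarith [norm_nonneg (G 0)]
  have hpos : 0 < 1 - ‖x‖ := by linarith
  have hC0 : 0 ≤ C := (norm_nonneg _).trans hG0
  rcases eq_or_ne x 0 with rfl | hx0
  · have := (norm_apply_le_of_norm_le_one hℓ (G 0)).trans hG0
    have : 0 ≤ (2 + 2 * C) / (1 - ‖(0 : V)‖) := by positivity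
    linarith
  obtain ⟨u, hu, hxu, hℓu⟩ := exists_unit_smul_eq_of_apply_eq_norm hx0 hℓx
  have hmaps : MapsTo (fun ζ : ℂ => ζ • u) (ball 0 1) (ball 0 1) :=
    fun ζ hζ => smul_mem_unitBall hu.le hζ
  have hgd : DifferentiableOn ℂ (fun ζ : ℂ => ℓ (G (ζ • u))) (ball 0 1) :=
    ℓ.differentiable.comp_differentiableOn
      (hG.1.comp (g := G) (f := fun ζ : ℂ => ζ • u) (by fun_prop) hmaps)
  have hderiv : ‖deriv (fun ζ : ℂ => ℓ (G (ζ • u))) 0‖ ≤ C := by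
    have h1 : HasDerivAt (fun ζ : ℂ => ζ • u) u 0 := by
      simpa using (hasDerivAt_id (0 : ℂ)).smul_const u
    have h2 : HasFDerivAt G (fderiv ℂ G 0) ((0 : ℂ) • u) := by
      rw [zero_smul]
      exact (hG.1.differentiableAt (ball_mem_nhds _ one_pos)).hasFDerivAt
    have h3 : HasDerivAt (fun ζ : ℂ => ℓ (G (ζ • u))) (ℓ (fderiv ℂ G 0 u)) 0 :=
      ℓ.hasFDerivAt.comp_hasDerivAt 0 (h2.comp_hasDerivAt 0 h1)
    rw [h3.deriv]
    refine (norm_apply_le_of_norm_le_one hℓ _).trans (((fderiv ℂ G 0).le_opNorm u).trans ?_)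
    rwa [hu, mul_one]
  have := norm_le_of_re_conj_mul_le hgd
    (fun ζ hζ => by simpa using hG.re_conj_mul_le hu.le hℓ hℓu hζ) (ζ := (‖x‖ : ℂ))
    (by simpa using hx)
  simp only [hxu, zero_smul, Complex.norm_real, norm_norm] at this
  refine this.trans ?_
  have := (norm_apply_le_of_norm_le_one hℓ (G 0)).trans hG0
  gcongr

/-- A holomorphic map whose numerical range is bounded on a ball is bounded on every smaller ball.
The Euler points of `f` with complex steps `s / N` stay in the ball when `s` is small, because the
growth of their norm only involves the numerical range; they are holomorphic in `s` with derivative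
`f x` at `s = 0`, so that Cauchy's estimate bounds `f x`. -/
lemma norm_le_of_numericalRange_bound [ProperSpace V] {f : V → V}
    (hf : DifferentiableOn ℂ f (ball 0 1)) {r r' M : ℝ} (hr : r < r') (hr' : r' < 1) (hM0 : 0 < M)
    (hM : ∀ x, ‖x‖ ≤ r' → ∀ ℓ : V →L[ℂ] ℂ, ‖ℓ‖ ≤ 1 → ℓ x = ‖x‖ → ‖ℓ (f x)‖ ≤ M)
    {x : V} (hx : ‖x‖ ≤ r) : ‖f x‖ ≤ 8 * M / (r' - r) := by
  obtain ⟨K, hK0, hK⟩ := exists_norm_le_of_continuousOn_ball hf.continuousOn hr'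
  obtain ⟨L, hL⟩ := exists_lipschitzOnWith_closedBall hf hr'
  have hrr : 0 < r' - r := sub_pos.2 hr
  set τ : ℝ := (r' - r) / (4 * M) with hτ
  have hτ0 : 0 < τ := by positivity
  have hτM : τ * (2 * M) = (r' - r) / 2 := by rw [hτ]; field_simp; norm_num
  obtain ⟨N, hN⟩ := exists_nat_gt (max (2 * τ * K / (r' - r)) (L * τ * K / M))
  have hN1 := (le_max_left _ _).trans_lt hN
  have hN2 := (le_max_right _ _).trans_lt hN
  have hNpos : (0 : ℝ) < N := lt_of_le_of_lt (by positivity) hN1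
  rw [div_lt_iff₀ hrr] at hN1
  rw [div_lt_iff₀ hM0] at hN2
  -- `hstep1` keeps a step that starts in the ball of radius `(r + r') / 2` inside the ball of radius
  -- `r'`; `hstep2` keeps the variation of `f` along a step below `M`.
  have hstep1 : τ / N * K ≤ (r' - r) / 2 := by
    rw [div_mul_eq_mul_div, div_le_iff₀ hNpos]; linarith
  have hstep2 : L * (τ / N * K) ≤ M := by
    rw [div_mul_eq_mul_div, mul_div_assoc', div_le_iff₀ hNpos]; linarith
  have hone : ∀ (h : ℂ) (y : V), ‖h‖ ≤ τ / N → ‖y‖ ≤ (r + r') / 2 →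
      ‖y + h • f y‖ ≤ ‖y‖ + ‖h‖ * (2 * M) := by
    intro h y hh hy
    have hyr : ‖y‖ ≤ r' := by linarith
    have hhf : ‖h • f y‖ ≤ τ / N * K := by
      rw [norm_smul]; exact mul_le_mul hh (hK y hyr).le (norm_nonneg _) (by positivity)
    have hy' : ‖y + h • f y‖ ≤ r' := (norm_add_le _ _).trans (by linarith)
    -- The functional supports the ball at the end point of the step, not at `y`: the numerical
    -- range at the end point then gives an upper bound of its norm.
    obtain ⟨ℓ, hℓ, hℓy⟩ := exists_dual_vector'' ℂ (y + h • f y)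
    have hnum := hM _ hy' ℓ hℓ hℓy
    have hlip : ‖f y - f (y + h • f y)‖ ≤ M := by
      have := hL.dist_le_mul y (by simpa using hyr) (y + h • f y) (by simpa using hy')
      rw [dist_eq_norm, dist_eq_norm, sub_add_cancel_left, norm_neg] at this
      exact this.trans ((mul_le_mul_of_nonneg_left hhf L.2).trans hstep2)
    have e : ((‖y + h • f y‖ : ℝ) : ℂ)
        = ℓ y + h * (ℓ (f (y + h • f y)) + ℓ (f y - f (y + h • f y))) := by
      refine hℓy.symm.trans ?_
      rw [map_add, map_smul, map_sub, smul_eq_mul]; ring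
    calc ‖y + h • f y‖ = ‖((‖y + h • f y‖ : ℝ) : ℂ)‖ := by simp
      _ ≤ ‖y‖ + ‖h‖ * (M + M) := by
        rw [e]
        refine (norm_add_le _ _).trans (add_le_add (norm_apply_le_of_norm_le_one hℓ y) ?_)
        rw [norm_mul]
        refine mul_le_mul_of_nonneg_left ((norm_add_le _ _).trans (add_le_add hnum ?_))
          (norm_nonneg _)
        exact (norm_apply_le_of_norm_le_one hℓ _).trans hlip
      _ = ‖y‖ + ‖h‖ * (2 * M) := by ring
  have hbound : ∀ s ∈ ball (0 : ℂ) τ, ∀ j ≤ N,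
      ‖eulerPoint f (s / N) x j‖ ≤ r + j * (τ / N) * (2 * M) := by
    intro s hs j
    have hh : ‖s / (N : ℂ)‖ ≤ τ / N := by
      rw [norm_div, Complex.norm_natCast]
      exact div_le_div_of_nonneg_right (mem_ball_zero_iff.1 hs).le hNpos.le
    induction j with
    | zero => intro _; simpa [eulerPoint] using hx
    | succ j ih =>
      intro hj
      have h1 := ih (by omega)
      have hjN : (j : ℝ) * (τ / N) ≤ N * (τ / N) := by gcongr; omega
      rw [mul_div_cancel₀ _ hNpos.ne'] at hjN
      have h2 : ‖eulerPoint f (s / N) x j‖ ≤ (r + r') / 2 := by nlinarith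
      refine (hone _ _ hh h2).trans ?_
      push_cast
      nlinarith
  have hbound1 : ∀ s ∈ ball (0 : ℂ) τ, ∀ j ≤ N, ‖eulerPoint f (s / N) x j‖ < 1 := by
    intro s hs j hj
    refine (hbound s hs j hj).trans_lt ?_
    have hjN : (j : ℝ) * (τ / N) ≤ N * (τ / N) := by gcongr
    rw [mul_div_cancel₀ _ hNpos.ne'] at hjN
    nlinarith
  have hdiff : DifferentiableOn ℂ (fun s : ℂ => eulerPoint f (s / N) x N) (ball 0 τ) :=
    differentiableOn_eulerPoint hf (h := fun s => s / N) (γ := fun _ => x) (by fun_prop)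
      (differentiableOn_const _) (fun s hs j hj => by simpa using hbound1 s hs j hj.le) N le_rfl
  have hxball : x ∈ ball (0 : V) 1 := by simpa using (by linarith : ‖x‖ < 1)
  have hzero : ∀ j, eulerPoint f ((0 : ℂ) / N) x j = x := by
    intro j
    induction j with
    | zero => rfl
    | succ j ih => rw [eulerPoint, ih]; simp
  have hder : ∀ j : ℕ, HasDerivAt (fun s : ℂ => eulerPoint f (s / N) x j)
      (((j : ℂ) / N) • f x) 0 := by
    intro j
    induction j with
    | zero => simpa [eulerPoint] using hasDerivAt_const (0 : ℂ) x
    | succ j ih =>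
      have hfx : DifferentiableAt ℂ f (eulerPoint f ((0 : ℂ) / N) x j) := by
        rw [hzero]; exact hf.differentiableAt (isOpen_ball.mem_nhds hxball)
      have h1 := (hfx.comp (0 : ℂ) ih.differentiableAt).hasDerivAt
      have h2 := ((hasDerivAt_id (0 : ℂ)).div_const (N : ℂ)).smul h1
      have h3 := ih.add h2
      simp only [Function.comp_apply, hzero] at h3
      simp only [id_eq, zero_div, zero_smul, zero_add] at h3
      rw [← add_smul, ← add_div] at h3
      rw [Nat.cast_add_one]
      exact h3
  have hNC : (N : ℂ) ≠ 0 := by exact_mod_cast hNpos.ne'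
  have hfin := norm_fderiv_le_of_norm_le_on_ball hτ0 hdiff
    (fun s hs => (hbound1 s hs N le_rfl).le)
  rw [← norm_deriv_eq_norm_fderiv, (hder N).deriv, div_self hNC, one_smul] at hfin
  refine hfin.trans (le_of_eq ?_)
  rw [hτ]; field_simp; norm_num

/-- Generators on the unit ball with a bounded `1`-jet at the origin are uniformly bounded on
smaller balls. -/
lemma exists_norm_le_of_isSemigroupGenerator (V : Type*) [NormedAddCommGroup V] [NormedSpace ℂ V]
    [ProperSpace V] (C : ℝ) {r : ℝ} (hr : r < 1) :
    ∃ M : ℝ, ∀ G : V → V, IsSemigroupGenerator (ball 0 1) G → ‖G 0‖ + ‖fderiv ℂ G 0‖ ≤ C →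
      ∀ x, ‖x‖ ≤ r → ‖G x‖ ≤ M := by
  obtain ⟨r', hrr', hr'⟩ := exists_between hr
  have hpos : 0 < 1 - r' := sub_pos.2 hr'
  refine ⟨_, fun G hG hC x hx => norm_le_of_numericalRange_bound hG.1 hrr' hr'
    (M := 2 * |C| + (2 + 2 * |C|) / (1 - r')) (by positivity) (fun y hy ℓ hℓ hℓy => ?_) hx⟩
  refine (hG.norm_apply_le (hC.trans (le_abs_self C)) (hy.trans_lt hr') hℓ hℓy).trans ?_
  gcongr

end NumericalRange

/-! ### Normal families -/

section Montel

variable {V W : Type*} [NormedAddCommGroup V] [NormedSpace ℂ V]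
  [NormedAddCommGroup W] [NormedSpace ℂ W]

lemma UniformCauchySeqOn.exists_tendstoUniformlyOn {ι X Y : Type*} [UniformSpace Y]
    [CompleteSpace Y] [Nonempty Y] {f : ℕ → X → Y} {s : ι → Set X}
    (h : ∀ i, UniformCauchySeqOn f atTop (s i)) :
    ∃ g : X → Y, ∀ i, TendstoUniformlyOn f g atTop (s i) := by
  have hlim : ∀ x, ∃ y, ∀ i, x ∈ s i → Tendsto (fun m => f m x) atTop (𝓝 y) := by
    intro x
    by_cases hx : ∃ i, x ∈ s i
    · obtain ⟨i, hi⟩ := hx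
      obtain ⟨y, hy⟩ := cauchySeq_tendsto_of_complete ((h i).cauchySeq hi)
      exact ⟨y, fun _ _ => hy⟩
    · exact ⟨Classical.arbitrary Y, fun i hi => absurd ⟨i, hi⟩ hx⟩
  choose g hg using hlim
  exact ⟨g, fun i => (h i).tendstoUniformlyOn_of_tendsto fun x hx => hg x i hx⟩

/-- The several-variables form of Weierstrass' theorem on the unit ball: by Cauchy's estimate the
derivatives converge locally uniformly as well. -/
lemma differentiableOn_of_tendstoUniformlyOn_closedBall [CompleteSpace W] {f : ℕ → V → W}
    {g : V → W} (hf : ∀ m, DifferentiableOn ℂ (f m) (ball 0 1))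
    (hfg : ∀ r < (1 : ℝ), TendstoUniformlyOn f g atTop (closedBall 0 r)) :
    DifferentiableOn ℂ g (ball 0 1) := by
  intro x hx
  obtain ⟨r, hxr, hr⟩ := exists_between (mem_ball_zero_iff.1 hx)
  obtain ⟨R, hrR, hR⟩ := exists_between hr
  have hRr : 0 < R - r := sub_pos.2 hrR
  have hdiff : ∀ m, ∀ y ∈ ball (0 : V) r, DifferentiableAt ℂ (f m) y := fun m y hy =>
    (hf m).differentiableAt (isOpen_ball.mem_nhds (ball_subset_ball hr.le hy))
  have hC : UniformCauchySeqOn (fun m => fderiv ℂ (f m)) atTop (ball 0 r) := by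
    rw [Metric.uniformCauchySeqOn_iff]
    intro ε hε
    obtain ⟨N, hN⟩ := Metric.uniformCauchySeqOn_iff.1 (hfg R hR).uniformCauchySeqOn
      (ε * (R - r) / 4) (by positivity)
    refine ⟨N, fun m hm k hk y hy => ?_⟩
    have hsub : ball y (R - r) ⊆ closedBall 0 R := by
      refine (ball_subset_ball' ?_).trans ball_subset_closedBall
      rw [dist_zero_right]; linarith [mem_ball_zero_iff.1 hy]
    have hsub' : ball y (R - r) ⊆ ball 0 1 := hsub.trans (closedBall_subset_ball hR)
    have h1 := norm_fderiv_le_of_norm_le_on_ball hRr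
      (((hf m).mono hsub').fun_sub ((hf k).mono hsub')) (M := ε * (R - r) / 4) fun w hw => by
        rw [← dist_eq_norm]; exact (hN m hm k hk w (hsub hw)).le
    rw [fderiv_fun_sub (hdiff m y hy) (hdiff k y hy), ← dist_eq_norm] at h1
    refine h1.trans_lt ?_
    rw [div_lt_iff₀ hRr]
    nlinarith [mul_pos hε hRr]
  obtain ⟨g', hg'⟩ := UniformCauchySeqOn.exists_tendstoUniformlyOn (fun _ : Unit => hC)
  have := hasFDerivAt_of_tendstoLocallyUniformlyOn isOpen_ball
    (hg' ()).tendstoLocallyUniformlyOn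
    (fun m y hy => (hdiff m y hy).hasFDerivAt)
    (fun y hy => (hfg r hr).tendsto_at (ball_subset_closedBall hy))
    (mem_ball_zero_iff.2 hxr)
  exact this.differentiableAt.differentiableWithinAt

/-- **Montel's theorem** on the unit ball. A subsequence that converges on a countable dense set is
extracted by Tychonoff's theorem; Cauchy's estimate makes the maps equi-Lipschitz on smaller balls,
and so the subsequence is uniformly Cauchy there. -/
lemma exists_subseq_tendstoUniformlyOn_closedBall [ProperSpace V] [ProperSpace W]
    {f : ℕ → V → W} (hf : ∀ m, DifferentiableOn ℂ (f m) (ball 0 1))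
    (hb : ∀ r < (1 : ℝ), ∃ M : ℝ, ∀ m x, ‖x‖ ≤ r → ‖f m x‖ ≤ M) :
    ∃ (φ : ℕ → ℕ) (g : V → W), StrictMono φ ∧
      ∀ r : {r : ℝ // r < 1}, TendstoUniformlyOn (fun k => f (φ k)) g atTop (closedBall 0 r) := by
  have : Nonempty (ball (0 : V) 1) := ⟨⟨0, mem_ball_self one_pos⟩⟩
  let d : ℕ → ball (0 : V) 1 := TopologicalSpace.denseSeq _
  have hd : DenseRange d := TopologicalSpace.denseRange_denseSeq _
  have hb' : ∀ i, ∃ M : ℝ, ∀ m, ‖f m (d i)‖ ≤ M := fun i =>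
    let ⟨M, hM⟩ := hb ‖(d i : V)‖ (mem_ball_zero_iff.1 (d i).2)
    ⟨M, fun m => hM m _ le_rfl⟩
  choose M hM using hb'
  obtain ⟨a, -, φ, hφ, ha⟩ := (isCompact_univ_pi fun i =>
    isCompact_closedBall (0 : W) (M i)).tendsto_subseq (x := fun m i => f m (d i))
    (fun m i _ => by simpa using hM i m)
  rw [tendsto_pi_nhds] at ha
  have hC : ∀ r : {r : ℝ // r < 1},
      UniformCauchySeqOn (fun k => f (φ k)) atTop (closedBall 0 (r : ℝ)) := by
    rintro ⟨r, hr⟩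
    obtain ⟨R, hrR, hR⟩ := exists_between hr
    obtain ⟨R', hRR', hR'⟩ := exists_between hR
    obtain ⟨K, hK⟩ := hb R' hR'
    have hR'R : 0 < R' - R := sub_pos.2 hRR'
    set L : ℝ := 2 * |K| / (R' - R)
    have hL : 0 ≤ L := by positivity
    have hlip : ∀ m, ∀ x y : V, ‖x‖ ≤ R → ‖y‖ ≤ R → ‖f m x - f m y‖ ≤ L * ‖x - y‖ :=
      fun m x y hx hy => norm_sub_le_of_norm_le_on_ball hRR'
        ((hf m).mono (ball_subset_ball hR'.le))
        (fun w hw => (hK m w (mem_ball_zero_iff.1 hw).le).trans (le_abs_self K)) hx hy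
    rw [Metric.uniformCauchySeqOn_iff]
    intro ε hε
    set δ : ℝ := min (R - r) (ε / (4 * (L + 1)))
    have hδ : 0 < δ := lt_min (sub_pos.2 hrR) (by positivity)
    have hδε : L * δ ≤ ε / 4 := by
      have h1 : δ ≤ ε / (4 * (L + 1)) := min_le_right _ _
      rw [le_div_iff₀ (by positivity)] at h1
      nlinarith
    obtain ⟨t, ht⟩ := (isCompact_closedBall (0 : V) r).elim_finite_subcover
      (fun i => ball (d i : V) δ) (fun _ => isOpen_ball) (fun x hx => by
        have hx1 : x ∈ ball (0 : V) 1 := closedBall_subset_ball hr hx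
        obtain ⟨i, hi⟩ := hd.exists_dist_lt ⟨x, hx1⟩ hδ
        exact mem_iUnion.2 ⟨i, hi⟩)
    have hN : ∀ᶠ N in atTop, ∀ i ∈ t, ∀ m ≥ N, dist (f (φ m) (d i)) (a i) < ε / 8 := by
      rw [eventually_all_finset]
      intro i _
      obtain ⟨N, hN⟩ := Metric.tendsto_atTop.1 (ha i) (ε / 8) (by positivity)
      filter_upwards [eventually_ge_atTop N] with n hn m hm using hN m (hn.trans hm)
    obtain ⟨N, hN⟩ := hN.exists
    refine ⟨N, fun m hm k hk x hx => ?_⟩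
    obtain ⟨i, hit, hi⟩ := mem_iUnion₂.1 (ht hx)
    rw [mem_ball, dist_eq_norm] at hi
    rw [mem_closedBall_zero_iff] at hx
    have hdi : ‖(d i : V)‖ ≤ R := by
      have h1 : ‖(d i : V)‖ ≤ ‖x‖ + ‖x - d i‖ := by
        have := norm_sub_le x (x - d i)
        rwa [sub_sub_cancel] at this
      linarith [min_le_left (R - r) (ε / (4 * (L + 1)))]
    have hLx : ∀ j, dist (f (φ j) x) (f (φ j) (d i)) ≤ ε / 4 := fun j => by
      rw [dist_eq_norm]
      exact (hlip _ _ _ (hx.trans hrR.le) hdi).trans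
        ((mul_le_mul_of_nonneg_left hi.le hL).trans hδε)
    have h1 := dist_triangle4 (f (φ m) x) (f (φ m) (d i)) (f (φ k) (d i)) (f (φ k) x)
    have h2 := dist_triangle_right (f (φ m) (d i)) (f (φ k) (d i)) (a i)
    have h3 := hLx m
    have h4 := hLx k
    rw [dist_comm] at h4
    linarith [hN i hit m hm, hN i hit k hk]
  obtain ⟨g, hg⟩ := UniformCauchySeqOn.exists_tendstoUniformlyOn hC
  exact ⟨φ, g, hφ, hg⟩

end Montel

/-! ### Limits of generators -/

section Limits

variable {V : Type*} [NormedAddCommGroup V] [NormedSpace ℂ V] [ProperSpace V] {G : V → V}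

/-- Near the unit sphere the outward radial speed of a generator is at most a fixed multiple of the
distance to the sphere. -/
lemma IsSemigroupGenerator.re_apply_le (hG : IsSemigroupGenerator (ball 0 1) G) {C : ℝ}
    (hC : ‖G 0‖ ≤ C) {x : V} (hx : ‖x‖ < 1) {ℓ : V →L[ℂ] ℂ} (hℓ : ‖ℓ‖ ≤ 1) (hℓx : ℓ x = ‖x‖) :
    (ℓ (G x)).re ≤ 2 * C * (1 - ‖x‖) := by
  have hC0 : 0 ≤ C := (norm_nonneg _).trans hC
  have hℓ0 : (ℓ (G 0)).re ≤ C :=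
    (Complex.re_le_norm _).trans ((norm_apply_le_of_norm_le_one hℓ _).trans hC)
  rcases eq_or_ne x 0 with rfl | hx0
  · simp only [norm_zero, sub_zero, mul_one]; linarith
  have hpos : 0 < ‖x‖ := norm_pos_iff.2 hx0
  obtain ⟨u, hu, hxu, hℓu⟩ := exists_unit_smul_eq_of_apply_eq_norm hx0 hℓx
  have h := hG.re_conj_mul_le hu.le hℓ hℓu (ζ := (‖x‖ : ℂ)) (by simpa using hx)
  rw [hxu, Complex.conj_ofReal, Complex.re_ofReal_mul, Complex.re_ofReal_mul, Complex.norm_real,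
    norm_norm, mul_assoc] at h
  have h2 := le_of_mul_le_mul_left h hpos
  have h3 : 0 ≤ 1 - ‖x‖ ^ 2 := by nlinarith
  nlinarith [mul_le_mul_of_nonneg_right hℓ0 h3, mul_nonneg hC0 (sq_nonneg (1 - ‖x‖))]

/-- Trajectories of a generator approach the boundary at most exponentially fast, at a rate that
depends only on the value of the generator at the origin. -/
lemma IsSemigroupGenerator.norm_trajectory_le (hG : IsSemigroupGenerator (ball 0 1) G) {C : ℝ}
    (hC0 : 0 < C) (hC : ‖G 0‖ ≤ C) {z : ℝ → V} (hz : IsTrajectory (ball 0 1) G z) {t : ℝ}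
    (ht : 0 ≤ t) : ‖z t‖ ≤ 1 - (1 - ‖z 0‖) * Real.exp (-(2 * C) * t) := by
  have hGz : ContinuousOn (fun s => G (z s)) (Ici 0) :=
    hG.1.continuousOn.comp hz.continuousOn fun s hs => hz.1 s hs
  have key := le_gronwallBound_of_liminf_deriv_right_le (f := fun s => ‖z s‖)
    (f' := fun s => 2 * C * (1 - ‖z s‖)) (δ := ‖z 0‖) (K := -(2 * C)) (ε := 2 * C) (a := 0) (b := t)
    (hz.continuousOn.norm.mono Icc_subset_Ici_self) (fun s hs r hr => ?_) le_rfl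
    (fun s _ => by linarith) t ⟨ht, le_rfl⟩
  · refine key.trans (le_of_eq ?_)
    rw [gronwallBound_of_K_ne_0 (by linarith : -(2 * C) ≠ 0), sub_zero, div_neg,
      div_self (by positivity)]
    ring
  · have hIoi : Ioi s ⊆ Ici 0 := Ioi_subset_Ici_iff.2 hs.1
    have hs0 : ContinuousWithinAt z (Ioi s) s := (hz.continuousOn s hs.1).mono hIoi
    have hslope : Tendsto (slope z s) (𝓝[>] s) (𝓝 (G (z s))) := by
      have := hasDerivWithinAt_iff_tendsto_slope.1 (hz.hasDerivWithinAt_Ici hs.1)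
      rwa [Ici_sdiff_left] at this
    have hlim : Tendsto (fun w => 2 * C * (1 - ‖z w‖) + ‖slope z s w - G (z w)‖) (𝓝[>] s)
        (𝓝 (2 * C * (1 - ‖z s‖) + ‖G (z s) - G (z s)‖)) :=
      ((hs0.norm.tendsto.const_sub 1).const_mul (2 * C)).add
        (hslope.sub ((hGz s hs.1).mono hIoi).tendsto).norm
    rw [sub_self, norm_zero, add_zero] at hlim
    refine Eventually.frequently ?_
    filter_upwards [hlim.eventually_lt_const hr, self_mem_nhdsWithin] with w hw hsw
    refine lt_of_le_of_lt ?_ hw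
    have hsw' : 0 < w - s := sub_pos.2 hsw
    -- The functional supports the ball at the later point `z w`, which bounds the increment of the
    -- norm from above.
    obtain ⟨ℓ, hℓ, hℓz⟩ := exists_dual_vector'' ℂ (z w)
    have h1 : ‖z w‖ - ‖z s‖ ≤ (ℓ (z w - z s)).re := by
      rw [map_sub, Complex.sub_re, hℓz]
      have := (Complex.re_le_norm _).trans (norm_apply_le_of_norm_le_one hℓ (z s))
      exact sub_le_sub_left this _
    have h2 : (w - s)⁻¹ * (ℓ (z w - z s)).re = (ℓ (G (z w))).re + (ℓ (slope z s w - G (z w))).re := by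
      rw [← Complex.add_re, ← map_add, add_sub_cancel, slope_def_module,
        ← Complex.coe_smul, map_smul, smul_eq_mul, Complex.re_ofReal_mul]
    calc (w - s)⁻¹ * (‖z w‖ - ‖z s‖) ≤ (w - s)⁻¹ * (ℓ (z w - z s)).re := by gcongr
      _ ≤ _ := by
        rw [h2]
        exact add_le_add
          (hG.re_apply_le hC (by simpa using hz.1 w (hIoi hsw)) hℓ hℓz)
          ((Complex.re_le_norm _).trans (norm_apply_le_of_norm_le_one hℓ _))

/-- A locally uniform limit of generators with bounded values at the origin is a generator. The
trajectories from a given point stay in a common compact set over bounded time intervals, so that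
they converge by Grönwall's inequality, and the limit solves the limiting integral equation. -/
lemma isSemigroupGenerator_of_tendsto {F : ℕ → V → V}
    (hF : ∀ m, IsSemigroupGenerator (ball 0 1) (F m)) (hG : DifferentiableOn ℂ G (ball 0 1))
    (hFG : ∀ r < (1 : ℝ), TendstoUniformlyOn F G atTop (closedBall 0 r)) {C : ℝ}
    (hC : ∀ m, ‖F m 0‖ ≤ C) : IsSemigroupGenerator (ball 0 1) G := by
  refine ⟨hG, fun z₀ hz₀ => ?_⟩
  choose Z hZ0 hZ using fun m => (hF m).2 z₀ hz₀
  have hC1 : 0 < |C| + 1 := by positivity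
  set R : ℝ → ℝ := fun T => 1 - (1 - ‖z₀‖) * Real.exp (-(2 * (|C| + 1)) * T) with hR_def
  have hz₀1 : 0 < 1 - ‖z₀‖ := sub_pos.2 (mem_ball_zero_iff.1 hz₀)
  have hR1 : ∀ T, R T < 1 := fun T => by
    have : 0 < (1 - ‖z₀‖) * Real.exp (-(2 * (|C| + 1)) * T) := by positivity
    simp only [hR_def]; linarith
  have hZR : ∀ m T, ∀ t ∈ Icc 0 T, ‖Z m t‖ ≤ R T := by
    intro m T t ht
    have h1 := (hF m).norm_trajectory_le hC1
      ((hC m).trans ((le_abs_self C).trans (by linarith))) (hZ m) ht.1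
    rw [hZ0] at h1
    refine h1.trans ?_
    simp only [hR_def]
    gcongr 1 - (1 - ‖z₀‖) * Real.exp ?_
    nlinarith [ht.2]
  have hcauchy : ∀ T : ℝ, UniformCauchySeqOn Z atTop (Icc 0 T) := by
    intro T
    rcases lt_or_ge T 0 with hT | hT
    · simp [Icc_eq_empty hT.not_ge, Metric.uniformCauchySeqOn_iff]
    obtain ⟨L, hL⟩ := exists_lipschitzOnWith_closedBall hG (hR1 T)
    rw [Metric.uniformCauchySeqOn_iff]
    intro η hη
    have hg : Tendsto (fun ε => gronwallBound 0 L (ε + ε) T) (𝓝[>] 0) (𝓝 0) := by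
      have hadd : Continuous fun ε : ℝ => ε + ε := by fun_prop
      have h1 := ((gronwallBound_continuous_ε 0 L T).comp hadd).tendsto 0
      simp only [Function.comp_apply, add_zero, gronwallBound_ε0_δ0] at h1
      exact h1.mono_left nhdsWithin_le_nhds
    obtain ⟨ε, hεη, hε⟩ := ((hg.eventually_lt_const hη).and self_mem_nhdsWithin).exists
    have hε : 0 < ε := hε
    obtain ⟨N, hN⟩ := eventually_atTop.1 (Metric.tendstoUniformlyOn_iff.1 (hFG _ (hR1 T)) ε hε)
    have hmem : ∀ m, ∀ t ∈ Icc 0 T, Z m t ∈ closedBall (0 : V) (R T) := fun m t ht =>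
      mem_closedBall_zero_iff.2 (hZR m T t ht)
    have happ : ∀ m ≥ N, ∀ t ∈ Ico 0 T, dist (F m (Z m t)) (G (Z m t)) ≤ ε := fun m hm t ht => by
      rw [dist_comm]; exact (hN m hm _ (hmem m t (Ico_subset_Icc_self ht))).le
    refine ⟨N, fun m hm k hk t ht => ?_⟩
    have := dist_le_of_approx_trajectories_ODE_of_mem (v := fun _ => G) (K := L) (a := 0) (b := T)
      (s := fun _ => closedBall 0 (R T)) (δ := 0) (fun _ _ => hL)
      ((hZ m).continuousOn.mono Icc_subset_Ici_self)
      (fun t ht => (hZ m).hasDerivWithinAt_Ici ht.1) (happ m hm)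
      (fun t ht => hmem m t (Ico_subset_Icc_self ht))
      ((hZ k).continuousOn.mono Icc_subset_Ici_self)
      (fun t ht => (hZ k).hasDerivWithinAt_Ici ht.1) (happ k hk)
      (fun t ht => hmem k t (Ico_subset_Icc_self ht)) (by rw [hZ0, hZ0, dist_self]) t ht
    rw [sub_zero] at this
    exact (this.trans (gronwallBound_mono le_rfl (by positivity) L.2 ht.2)).trans_lt hεη
  obtain ⟨z, hz⟩ := UniformCauchySeqOn.exists_tendstoUniformlyOn hcauchy
  have hpt : ∀ t, 0 ≤ t → Tendsto (fun m => Z m t) atTop (𝓝 (z t)) := fun t ht =>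
    (hz t).tendsto_at ⟨ht, le_rfl⟩
  have hz0 : z 0 = z₀ := by
    refine tendsto_nhds_unique (hpt 0 le_rfl) ?_
    simp only [hZ0, tendsto_const_nhds_iff]
  have hzR : ∀ T, ∀ t ∈ Icc 0 T, ‖z t‖ ≤ R T := fun T t ht =>
    le_of_tendsto (hpt t ht.1).norm (Eventually.of_forall fun m => hZR m T t ht)
  have hzmem : ∀ t, 0 ≤ t → z t ∈ ball (0 : V) 1 := fun t ht =>
    mem_ball_zero_iff.2 ((hzR t t ⟨ht, le_rfl⟩).trans_lt (hR1 t))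
  have hzcont : ContinuousOn z (Ici 0) := by
    intro t ht
    have h1 : ContinuousOn z (Icc 0 (t + 1)) := (hz (t + 1)).continuousOn
      (Eventually.of_forall fun m => (hZ m).continuousOn.mono Icc_subset_Ici_self).frequently
    have ht' : (0 : ℝ) ≤ t := ht
    have h2 : Icc 0 (t + 1) ∈ 𝓝[Ici 0] t := by
      rw [← Ici_inter_Iic]
      exact inter_mem self_mem_nhdsWithin
        (mem_nhdsWithin_of_mem_nhds (Iic_mem_nhds (by linarith)))
    exact (h1 t ⟨ht, by linarith⟩).mono_of_mem_nhdsWithin h2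
  -- The velocity is extended to negative times by a constant, so that the fundamental theorem of
  -- calculus applies at `0` too.
  set v : ℝ → V := fun s => G (z (max s 0)) with hv
  have hvcont : Continuous v :=
    (hG.continuousOn.comp hzcont fun s hs => hzmem s hs).comp_continuous
      (continuous_id.max continuous_const) fun s => mem_Ici.2 (le_max_right s 0)
  have hint : ∀ t, 0 ≤ t → z t = z₀ + ∫ s in (0 : ℝ)..t, v s := by
    intro t ht
    have hIcc : uIcc 0 t ⊆ Ici 0 := by rw [uIcc_of_le ht]; exact Icc_subset_Ici_self
    have hcm : ∀ m, ContinuousOn (fun s => F m (Z m s)) (uIcc 0 t) := fun m =>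
      ((hF m).1.continuousOn.comp (hZ m).continuousOn fun s hs => (hZ m).1 s hs).mono hIcc
    have h1 : ∀ m, ∫ s in (0 : ℝ)..t, F m (Z m s) = Z m t - z₀ := by
      intro m
      rw [intervalIntegral.integral_eq_sub_of_hasDeriv_right ((hZ m).continuousOn.mono hIcc)
        (fun s hs => ((hZ m).hasDerivWithinAt_Ici ?_).mono Ioi_subset_Ici_self)
        (hcm m).intervalIntegrable, hZ0]
      rw [min_eq_left ht] at hs
      exact hs.1.le
    obtain ⟨M, hM0, hM⟩ := exists_norm_le_of_continuousOn_ball hG.continuousOn (hR1 t)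
    have hsub : ∀ s, s ∈ Set.uIoc 0 t → s ∈ Icc 0 t := fun s hs => by
      rw [uIoc_of_le ht] at hs; exact Ioc_subset_Icc_self hs
    have h2 : Tendsto (fun m => ∫ s in (0 : ℝ)..t, F m (Z m s)) atTop
        (𝓝 (∫ s in (0 : ℝ)..t, v s)) := by
      refine intervalIntegral.tendsto_integral_filter_of_dominated_convergence (fun _ => M + 1)
        (Eventually.of_forall fun m =>
          ((hcm m).mono uIoc_subset_uIcc).aestronglyMeasurable measurableSet_uIoc)
        ?_ intervalIntegrable_const (Eventually.of_forall fun s hs => ?_)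
      · filter_upwards [Metric.tendstoUniformlyOn_iff.1 (hFG _ (hR1 t)) 1 one_pos] with m hm
        refine Eventually.of_forall fun s hs => ?_
        have hb := hZR m t s (hsub s hs)
        have h3 := hm (Z m s) (mem_closedBall_zero_iff.2 hb)
        rw [dist_comm, dist_eq_norm] at h3
        have h4 := norm_sub_norm_le (F m (Z m s)) (G (Z m s))
        linarith [hM _ hb]
      · have hs' := hsub s hs
        rw [hv]
        simp only [max_eq_left hs'.1]
        refine (hFG _ (hR1 t)).tendsto_comp
          (hG.continuousOn.mono (closedBall_subset_ball (hR1 t)) _ ?_) ?_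
        · exact mem_closedBall_zero_iff.2 (hzR t s hs')
        · exact tendsto_nhdsWithin_iff.2 ⟨hpt s hs'.1, Eventually.of_forall fun m =>
            mem_closedBall_zero_iff.2 (hZR m t s hs')⟩
    simp only [h1] at h2
    rw [← tendsto_nhds_unique ((hpt t ht).sub_const z₀) h2, add_sub_cancel]
  refine ⟨z, hz0, hzmem, fun t ht => ?_⟩
  have ht' : (0 : ℝ) ≤ t := ht
  have h1 : HasDerivAt (fun t => z₀ + ∫ s in (0 : ℝ)..t, v s) (v t) t :=
    (hvcont.integral_hasStrictDerivAt 0 t).hasDerivAt.const_add z₀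
  rw [hv] at h1
  simp only [max_eq_left ht'] at h1
  exact h1.hasDerivWithinAt.congr (fun s hs => hint s hs) (hint t ht')

end Limits

/-! ### Compactness on the unit ball -/

section UnitBall

variable {V : Type*} [NormedAddCommGroup V] [NormedSpace ℂ V] [ProperSpace V]

/-- The compactness theorem when the domain is the open unit ball of a norm. -/
lemma exists_subseq_isSemigroupGenerator {G : ℕ → V → V}
    (hG : ∀ m, IsSemigroupGenerator (ball 0 1) (G m)) {C : ℝ}
    (hC : ∀ m, ‖G m 0‖ + ‖fderiv ℂ (G m) 0‖ ≤ C) :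
    ∃ (φ : ℕ → ℕ) (g : V → V), StrictMono φ ∧ IsSemigroupGenerator (ball 0 1) g ∧
      ∀ r < (1 : ℝ), TendstoUniformlyOn (fun k => G (φ k)) g atTop (closedBall 0 r) := by
  obtain ⟨φ, g, hφ, hg⟩ := exists_subseq_tendstoUniformlyOn_closedBall (fun m => (hG m).1)
    (fun r hr => by
      obtain ⟨M, hM⟩ := exists_norm_le_of_isSemigroupGenerator V C hr
      exact ⟨M, fun m => hM (G m) (hG m) (hC m)⟩)
  have hg' : ∀ r < (1 : ℝ), TendstoUniformlyOn (fun k => G (φ k)) g atTop (closedBall 0 r) :=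
    fun r hr => hg ⟨r, hr⟩
  refine ⟨φ, g, hφ, isSemigroupGenerator_of_tendsto (fun k => hG (φ k))
    (differentiableOn_of_tendstoUniformlyOn_closedBall (fun k => (hG (φ k)).1) hg') hg'
    (C := C) (fun k => ?_), hg'⟩
  linarith [hC (φ k), norm_nonneg (fderiv ℂ (G (φ k)) 0)]

end UnitBall

/-! ### Bounded balanced convex domains as unit balls -/

section Renorming

universe u

/-- A copy of `E` that keeps its vector space structure, but neither norm nor topology. -/
def Renormed (E : Type*) : Type _ := E

instance (E : Type*) [AddCommGroup E] : AddCommGroup (Renormed E) :=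
  inferInstanceAs (AddCommGroup E)

instance (E : Type*) [AddCommGroup E] [Module ℂ E] : Module ℂ (Renormed E) :=
  inferInstanceAs (Module ℂ E)

/-- A bounded balanced convex domain is, up to a linear isomorphism, the open unit ball of a norm,
namely of its gauge. -/
lemma exists_continuousLinearEquiv_norm_lt_one {E : Type u} [NormedAddCommGroup E]
    [NormedSpace ℂ E] [FiniteDimensional ℂ E] {D : Set E} (hD_open : IsOpen D)
    (hD_ne : D.Nonempty) (hD_bdd : Bornology.IsBounded D) (hD_bal : Balanced ℂ D)
    (hD_conv : Convex ℝ D) :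
    ∃ (V : Type u) (_ : NormedAddCommGroup V) (_ : NormedSpace ℂ V) (e : E ≃L[ℂ] V),
      ∀ x, x ∈ D ↔ ‖e x‖ < 1 := by
  have h0 : (0 : E) ∈ D := hD_bal.zero_mem hD_ne
  have habs : Absorbent ℝ D := absorbent_nhds_zero (hD_open.mem_nhds h0)
  let p : Seminorm ℂ (Renormed E) := gaugeSeminorm (E := E) hD_bal hD_conv habs
  have hp : ∀ x : E, p x = gauge D x := fun _ => rfl
  let N : NormedAddCommGroup (Renormed E) := AddGroupNorm.toNormedAddCommGroup
    { p.toAddGroupSeminorm with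
      eq_zero_of_map_eq_zero' := fun x hx =>
        (gauge_eq_zero habs (NormedSpace.isVonNBounded_of_isBounded ℝ hD_bdd)).1 hx }
  let S : NormedSpace ℂ (Renormed E) :=
    { (inferInstance : Module ℂ (Renormed E)) with
      norm_smul_le := fun a x => (map_smul_eq_mul p a x).le }
  let e₀ : E ≃ₗ[ℂ] Renormed E := LinearEquiv.refl ℂ E
  refine ⟨Renormed E, N, S, e₀.toContinuousLinearEquiv, fun x => ?_⟩
  have hnorm : ‖e₀.toContinuousLinearEquiv x‖ = gauge D x := rfl
  rw [hnorm]
  exact (Set.ext_iff.1 (setOfPred_gauge_lt_one_eq_self_of_isOpen hD_conv h0 hD_open) x).symm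

variable {V W : Type*} [NormedAddCommGroup V] [NormedSpace ℂ V]
  [NormedAddCommGroup W] [NormedSpace ℂ W]

/-- Being a generator is invariant under linear changes of coordinates. -/
lemma IsSemigroupGenerator.conj {D : Set V} {G : V → V} (hG : IsSemigroupGenerator D G)
    (e : V ≃L[ℂ] W) {D' : Set W} (hD : ∀ x, x ∈ D ↔ e x ∈ D') :
    IsSemigroupGenerator D' (fun y => e (G (e.symm y))) := by
  have hD' : ∀ y ∈ D', e.symm y ∈ D := fun y hy => (hD _).2 (by simpa using hy)
  refine ⟨e.differentiable.comp_differentiableOn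
    (hG.1.comp e.symm.differentiable.differentiableOn hD'), fun y hy => ?_⟩
  obtain ⟨z, hz0, hz⟩ := hG.2 _ (hD' y hy)
  refine ⟨fun t => e (z t), by simp [hz0], fun t ht => (hD _).1 (hz.1 t ht), fun t ht => ?_⟩
  have := ((e : V →L[ℂ] W).restrictScalars ℝ).hasFDerivAt.comp_hasDerivWithinAt t
    (hz.hasDerivWithinAt ht)
  simp only [e.symm_apply_apply]
  exact this

lemma norm_conj_add_norm_fderiv_conj_le {G : V → V} (hG : DifferentiableAt ℂ G 0)
    (e : V ≃L[ℂ] W) {C : ℝ} (hC : ‖G 0‖ + ‖fderiv ℂ G 0‖ ≤ C) :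
    ‖e (G (e.symm 0))‖ + ‖fderiv ℂ (fun y => e (G (e.symm y))) 0‖
      ≤ ‖(e : V →L[ℂ] W)‖ * C + ‖(e : V →L[ℂ] W)‖ * (C * ‖(e.symm : W →L[ℂ] V)‖) := by
  have hG0 : ‖G 0‖ ≤ C := by linarith [norm_nonneg (fderiv ℂ G 0)]
  have hG1 : ‖fderiv ℂ G 0‖ ≤ C := by linarith [norm_nonneg (G 0)]
  have hGe : HasFDerivAt G (fderiv ℂ G 0) (e.symm 0) := by
    rw [map_zero]; exact hG.hasFDerivAt
  have hd : HasFDerivAt (fun y => e (G (e.symm y)))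
      ((e : V →L[ℂ] W).comp ((fderiv ℂ G 0).comp (e.symm : W →L[ℂ] V))) 0 :=
    (e : V →L[ℂ] W).hasFDerivAt.comp 0 (hGe.comp 0 (e.symm : W →L[ℂ] V).hasFDerivAt)
  rw [hd.fderiv, map_zero]
  gcongr
  · exact ((e : V →L[ℂ] W).le_opNorm _).trans (by gcongr)
  · refine (ContinuousLinearMap.opNorm_comp_le _ _).trans ?_
    gcongr
    exact (ContinuousLinearMap.opNorm_comp_le _ _).trans (by gcongr)

end Renorming

theorem corollary1p7 (n : ℕ) (D : Set (EuclideanSpace ℂ (Fin n)))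
    (hD_open : IsOpen D) (hD_ne : D.Nonempty) (hD_bdd : Bornology.IsBounded D)
    (hD_bal : Balanced ℂ D) (hD_conv : Convex ℝ D)
    (G : ℕ → EuclideanSpace ℂ (Fin n) → EuclideanSpace ℂ (Fin n))
    (hG : ∀ m, IsInfinitesimalGenerator D (G m))
    (C : ℝ) (hC : ∀ m, ‖G m 0‖ + ‖fderiv ℂ (G m) 0‖ ≤ C) :
    ∃ (φ : ℕ → ℕ) (Ginf : EuclideanSpace ℂ (Fin n) → EuclideanSpace ℂ (Fin n)),
      StrictMono φ ∧ IsInfinitesimalGenerator D Ginf ∧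
        ∀ K : Set (EuclideanSpace ℂ (Fin n)), K ⊆ D → IsCompact K →
          TendstoUniformlyOn (fun k => G (φ k)) Ginf atTop K := by
  obtain ⟨V, _, _, e, he⟩ :=
    exists_continuousLinearEquiv_norm_lt_one hD_open hD_ne hD_bdd hD_bal hD_conv
  have hproper : ProperSpace V :=
    have := e.toLinearEquiv.finiteDimensional
    FiniteDimensional.proper ℂ _
  have hmem : ∀ x, x ∈ D ↔ e x ∈ ball (0 : V) 1 := fun x => by
    rw [mem_ball_zero_iff, he]
  have hG' : ∀ m, IsSemigroupGenerator D (G m) := hG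
  have h0 : D ∈ 𝓝 0 := hD_open.mem_nhds (hD_bal.zero_mem hD_ne)
  obtain ⟨φ, g, hφ, hg, hlim⟩ := exists_subseq_isSemigroupGenerator
    (fun m => (hG' m).conj e hmem)
    (fun m => norm_conj_add_norm_fderiv_conj_le ((hG' m).1.differentiableAt h0) e (hC m))
  have hGinf : IsSemigroupGenerator D (fun x => e.symm (g (e x))) := by
    have := hg.conj e.symm (D' := D) fun y => by rw [hmem, e.apply_symm_apply]
    simpa using this
  refine ⟨φ, _, hφ, hGinf, fun K hKD hK => ?_⟩
  obtain ⟨r, hr, hKr⟩ : ∃ r < (1 : ℝ), ∀ x ∈ K, ‖e x‖ ≤ r := by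
    rcases K.eq_empty_or_nonempty with rfl | hne
    · exact ⟨0, one_pos, by simp⟩
    · obtain ⟨x, hx, hmax⟩ := hK.exists_isMaxOn hne e.continuous.norm.continuousOn
      exact ⟨‖e x‖, (he x).1 (hKD hx), fun y hy => hmax hy⟩
  have huc := (e.symm : V →L[ℂ] EuclideanSpace ℂ (Fin n)).uniformContinuous
  have h1 := huc.comp_tendstoUniformlyOn ((hlim r hr).comp e)
  refine (h1.mono fun x hx => mem_closedBall_zero_iff.2 (hKr x hx)).congr
    (Eventually.of_forall fun k x _ => ?_)
  simp
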